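/- Let $G$ be a group and let $A,B$ be locally cyclic subgroups of $G$ (that is, every finitely generated subgroup of $A$, and of $B$, is cyclic) such that $G=AB=\{xy\mid x\in A,\ y\in B\}$, where $A$ is periodic and $B$ is non-trivial and torsion-free. Write $x^y=y^{-1}xy$. Then one of the following statements holds: 1) the subgroup $A$ is normal in $G$ and $G=A\rtimes B$ (that is, $G=AB$ and $A\cap B=1$); 2) there are a subgroup $A_1\le A$ and an element $a\in A$ with $A=A_1\langle a\rangle$ and $a^2\in A_1$ such that $A_1$ is normal in $G$, $A_1\cap B=1$, $G=(A_1\rtimes B)\langle a\rangle$, and $b^a=b^{-1}\phi(b)$ for all $b\in B$, where $\phi:B\to A_1$ is a derivation with respect to the conjugation action of $B$ on $A_1$, i.e. $\phi(bc)=\phi(b)^c\,\phi(c)$ for all $b,c\in B$. -/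

import Mathlib

open scoped Pointwise

/-- A group is locally cyclic if each of its finitely generated subgroups is cyclic. -/
def IsLocallyCyclic (G : Type*) [Group G] : Prop :=
  ∀ H : Subgroup G, H.FG → IsCyclic H

/-- `K = N ⋊ H` as an internal semidirect product of subgroups of an ambient group:
`N` is a normal subgroup of `K`, `H` is a subgroup of `K`, `K = NH` and `N ∩ H = 1`. -/
structure IsInternalSemidirect {G : Type*} [Group G] (K N H : Subgroup G) : Prop where
  left_le : N ≤ K
  right_le : H ≤ K
  normal : (N.subgroupOf K).Normal
  mul_eq : (N : Set G) * (H : Set G) = (K : Set G)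
  inf_eq : N ⊓ H = ⊥

/-- `φ : B → N` is a derivation (crossed homomorphism) with respect to the conjugation
action `x ^ b = b⁻¹ x b` of `B` on `N`, that is, `φ (b c) = φ (b) ^ c * φ (c)`.
When `B` and `N` are abelian this is the same as `φ (b c) = φ (b) * φ (c) ^ b`. -/
def IsConjDerivation {G : Type*} [Group G] {B N : Subgroup G} (φ : B → N) : Prop :=
  ∀ b c : B, (φ (b * c) : G) = ((c : G)⁻¹ * (φ b : G) * (c : G)) * (φ c : G)

/-! ### Consequences of local cyclicity: commutativity and rank one. -/

section LocallyCyclic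

variable {G : Type*} [Group G]

/-! Factor out the core `N` of `A`. In the quotient, Itô's subgroup `M = [A, B]` is abelian, normal
and torsion-free. For `m ∈ M`, commutation in `B` yields a midpoint relation which, by an invariant
quadratic form, makes the `A`-part of `m` centralize `m`; so a nonzero power of `m` lies in `B`.
Hence `M` has rank at most one and is centralized by `B`, while `A` acts on it faithfully and
periodically, that is, by signs. So the image of `A` has order at most two, and a nontrivial element
inverts the image of `B`. Pulling back, `A = N` or `A = N⟨a⟩`, with `φ b = b * b ^ a ∈ N`. -/

theorem IsLocallyCyclic.exists_zpow_eq {H : Subgroup G} (hH : IsLocallyCyclic H) {x y : G}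
    (hx : x ∈ H) (hy : y ∈ H) : ∃ (z : G) (i j : ℤ), x = z ^ i ∧ y = z ^ j := by
  have hcyc := hH (Subgroup.closure {⟨x, hx⟩, ⟨y, hy⟩})
    ((Subgroup.fg_iff _).2 ⟨_, rfl, Set.toFinite _⟩)
  obtain ⟨z, hz⟩ := hcyc.exists_generator
  obtain ⟨i, hi⟩ := Subgroup.mem_zpowers_iff.1
    (hz ⟨⟨x, hx⟩, Subgroup.subset_closure (Set.mem_insert _ _)⟩)
  obtain ⟨j, hj⟩ := Subgroup.mem_zpowers_iff.1
    (hz ⟨⟨y, hy⟩, Subgroup.subset_closure (Set.mem_insert_of_mem _ rfl)⟩)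
  refine ⟨((z : H) : G), i, j, ?_, ?_⟩
  · simpa using (congrArg (fun w : Subgroup.closure _ => ((w : H) : G)) hi).symm
  · simpa using (congrArg (fun w : Subgroup.closure _ => ((w : H) : G)) hj).symm

theorem IsLocallyCyclic.mul_comm {H : Subgroup G} (hH : IsLocallyCyclic H) {x y : G}
    (hx : x ∈ H) (hy : y ∈ H) : x * y = y * x := by
  obtain ⟨z, i, j, rfl, rfl⟩ := hH.exists_zpow_eq hx hy
  exact (Commute.refl z).zpow_zpow i j

/-- Besides commutativity, this is all that is used of the local cyclicity of `B`; for `A`,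
commutativity suffices. -/
theorem IsLocallyCyclic.exists_zpow_eq_zpow {H : Subgroup G} (hH : IsLocallyCyclic H) {x y : G}
    (hx : x ∈ H) (hy : y ∈ H) (hx1 : x ≠ 1) : ∃ r s : ℤ, r ≠ 0 ∧ y ^ r = x ^ s := by
  obtain ⟨z, i, j, rfl, rfl⟩ := hH.exists_zpow_eq hx hy
  refine ⟨i, j, ?_, ?_⟩
  · rintro rfl
    simp at hx1
  · rw [← zpow_mul, ← zpow_mul, _root_.mul_comm]

end LocallyCyclic

/-! ### Finite-order automorphisms and an invariant quadratic form. -/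

section TorsionFree

/-- Homomorphisms to `ℚ` separate the elements of infinite order of an abelian group. -/
theorem exists_addMonoidHom_rat_ne_zero {V : Type*} [AddCommGroup V] {u : V}
    (hu : ∀ n : ℤ, n • u = 0 → n = 0) : ∃ f : V →+ ℚ, f u ≠ 0 := by
  have hinj : Function.Injective (LinearMap.toSpanSingleton ℤ V u) := by
    rw [← LinearMap.ker_eq_bot, LinearMap.ker_eq_bot']
    intro n hn
    exact hu n (by simpa using hn)
  obtain ⟨h, hh⟩ := (Module.Baer.of_divisible ℚ).extension_property _ hinj
    (LinearMap.toSpanSingleton ℤ ℚ 1)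
  refine ⟨h.toAddMonoidHom, ?_⟩
  have := LinearMap.congr_fun hh 1
  simp at this
  simp [this]

/-- If `φ` and `ψ` are commuting automorphisms of finite order of a torsion-free abelian group
and `φ v` is the midpoint of `v` and `ψ v`, then `φ` fixes `v`. -/
theorem MulAut.apply_eq_of_sq_eq_mul {V : Type*} [CommGroup V]
    (htf : ∀ u : V, IsOfFinOrder u → u = 1) {φ ψ : MulAut V} (hcomm : Commute φ ψ)
    (hφ : IsOfFinOrder φ) (hψ : IsOfFinOrder ψ) {v : V} (h : φ v ^ 2 = v * ψ v) : φ v = v := by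
  obtain ⟨n, hn, hφn⟩ := isOfFinOrder_iff_pow_eq_one.1 hφ
  obtain ⟨k, hk, hψk⟩ := isOfFinOrder_iff_pow_eq_one.1 hψ
  by_contra hne
  obtain ⟨u, hu⟩ : ∃ u, u = φ v * v⁻¹ := ⟨_, rfl⟩
  have hu1 : u ≠ 1 := fun h => hne (mul_inv_eq_one.1 (hu ▸ h))
  obtain ⟨f, hf⟩ := exists_addMonoidHom_rat_ne_zero (u := Additive.ofMul u) (by
    intro m hm
    by_contra hm0
    exact hu1 (htf u (isOfFinOrder_iff_zpow_eq_one.2 ⟨m, hm0, hm⟩)))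
  -- Averaging `f ^ 2` over the powers of `φ` and `ψ` gives an invariant semidefinite form; its `i =
  -- j = 0` term detects `u`.
  let q (w : V) : ℚ := ∑ i ∈ Finset.range n, ∑ j ∈ Finset.range k,
    f (Additive.ofMul ((φ ^ i) ((ψ ^ j) w))) ^ 2
  have hqφ (w : V) : q (φ w) = q w := by
    have e (i : ℕ) : ∑ j ∈ Finset.range k, f (Additive.ofMul ((φ ^ i) ((ψ ^ j) (φ w)))) ^ 2
        = ∑ j ∈ Finset.range k, f (Additive.ofMul ((φ ^ (i + 1)) ((ψ ^ j) w))) ^ 2 := by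
      refine Finset.sum_congr rfl fun j _ => ?_
      have : (ψ ^ j) (φ w) = φ ((ψ ^ j) w) :=
        (DFunLike.congr_fun (hcomm.pow_right j).eq w).symm
      rw [this, pow_succ φ i, MulAut.mul_apply]
    simp only [q, e]
    have h1 := Finset.sum_range_succ (fun i => ∑ j ∈ Finset.range k,
      f (Additive.ofMul ((φ ^ i) ((ψ ^ j) w))) ^ 2) n
    have h2 := Finset.sum_range_succ' (fun i => ∑ j ∈ Finset.range k,
      f (Additive.ofMul ((φ ^ i) ((ψ ^ j) w))) ^ 2) n
    rw [hφn] at h1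
    rw [pow_zero] at h2
    linarith
  have hqψ (w : V) : q (ψ w) = q w := by
    refine Finset.sum_congr rfl fun i _ => ?_
    have e (j : ℕ) : (ψ ^ j) (ψ w) = (ψ ^ (j + 1)) w := by rw [pow_succ, MulAut.mul_apply]
    simp only [e]
    have h1 := Finset.sum_range_succ (fun j => f (Additive.ofMul ((φ ^ i) ((ψ ^ j) w))) ^ 2) k
    have h2 := Finset.sum_range_succ' (fun j => f (Additive.ofMul ((φ ^ i) ((ψ ^ j) w))) ^ 2) k
    rw [hψk] at h1
    rw [pow_zero] at h2
    linarith
  have hφv : φ v = v * u := by rw [hu, mul_comm, inv_mul_cancel_right]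
  have hψv : ψ v = v * u * u := by
    have : ψ v = v⁻¹ * φ v ^ 2 := by rw [h]; group
    rw [this, hφv, pow_two, mul_assoc v u, inv_mul_cancel_left, mul_left_comm, ← mul_assoc]
  -- Parallelogram law: `v`, `v * u = φ v` and `v * u * u = ψ v` have equal `q`, so `q u = 0`.
  have hpar : q (v * u * u) + q v = 2 * q (v * u) + 2 * q u := by
    simp only [q, Finset.mul_sum, ← Finset.sum_add_distrib, map_mul, ofMul_mul, map_add]
    refine Finset.sum_congr rfl fun i _ => Finset.sum_congr rfl fun j _ => ?_
    ring
  have h0 : q u = 0 := by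
    have h1 := hqφ v
    have h2 := hqψ v
    rw [hφv] at h1
    rw [hψv] at h2
    linarith
  have h1 := (Finset.sum_eq_zero_iff_of_nonneg
    (fun i _ => Finset.sum_nonneg fun j _ => sq_nonneg _)).1 h0 0 (Finset.mem_range.2 hn)
  have h2 := (Finset.sum_eq_zero_iff_of_nonneg (fun j _ => sq_nonneg _)).1 h1 0
    (Finset.mem_range.2 hk)
  exact hf (by simpa using h2)

end TorsionFree

/-! ### Itô's commutator argument. -/

section AbelianFactors

open scoped commutatorElement

variable {G : Type*} [Group G] {A B : Subgroup G}

/-- Itô: if `G = AB` with `A` and `B` abelian, then `[A, B]` is an abelian normal subgroup,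
with abelian quotient. -/
theorem exists_normal_comm_of_mul_eq_univ (hG : (A : Set G) * (B : Set G) = Set.univ)
    (hA : ∀ x ∈ A, ∀ y ∈ A, x * y = y * x) (hB : ∀ x ∈ B, ∀ y ∈ B, x * y = y * x) :
    ∃ M : Subgroup G, M.Normal ∧ (∀ x ∈ M, ∀ y ∈ M, x * y = y * x) ∧
      ∀ a ∈ A, ∀ b ∈ B, a * b * a⁻¹ * b⁻¹ ∈ M := by
  have hAB (g : G) : ∃ x ∈ A, ∃ y ∈ B, x * y = g := Set.mem_mul.1 (hG ▸ Set.mem_univ g)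
  have hBA (g : G) : ∃ y ∈ B, ∃ x ∈ A, y * x = g := by
    obtain ⟨x, hx, y, hy, h⟩ := hAB g⁻¹
    exact ⟨y⁻¹, inv_mem hy, x⁻¹, inv_mem hx, by rw [← mul_inv_rev, h, inv_inv]⟩
  -- That `c` does not depend on `a` is what later makes the conjugations by `x⁻¹` and `y⁻¹` commute
  -- on `⁅a, b⁆`.
  have hconjA : ∀ x ∈ A, ∀ b ∈ B, ∃ c ∈ B, ∀ a ∈ A, x * ⁅a, b⁆ * x⁻¹ = ⁅a, c⁆ := by
    intro x hx b hb
    obtain ⟨c, hc, a', ha', h⟩ := hBA (x * b * x⁻¹)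
    refine ⟨c, hc, fun a ha => ?_⟩
    calc x * ⁅a, b⁆ * x⁻¹ = (x * a * x⁻¹) * (x * b * x⁻¹) * (x * a * x⁻¹)⁻¹ * (x * b * x⁻¹)⁻¹ := by
          rw [commutatorElement_def]; group
      _ = a * c * (a' * a⁻¹) * a'⁻¹ * c⁻¹ := by
          rw [hA x hx a ha, ← h]; group
      _ = ⁅a, c⁆ := by
          rw [hA a' ha' a⁻¹ (inv_mem ha), commutatorElement_def]; group
  have hconjB : ∀ y ∈ B, ∀ a ∈ A, ∃ c ∈ A, ∀ b ∈ B, y * ⁅a, b⁆ * y⁻¹ = ⁅c, b⁆ := by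
    intro y hy a ha
    obtain ⟨c, hc, b', hb', h⟩ := hAB (y * a * y⁻¹)
    refine ⟨c, hc, fun b hb => ?_⟩
    calc y * ⁅a, b⁆ * y⁻¹ = (y * a * y⁻¹) * (y * b * y⁻¹) * (y * a * y⁻¹)⁻¹ * (y * b * y⁻¹)⁻¹ := by
          rw [commutatorElement_def]; group
      _ = c * (b' * b) * b'⁻¹ * c⁻¹ * b⁻¹ := by
          rw [hB y hy b hb, ← h]; group
      _ = ⁅c, b⁆ := by
          rw [hB b' hb' b hb, commutatorElement_def]; group
  have hcl := Subgroup.commutator_def A B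
  refine ⟨⁅A, B⁆, ⟨?_⟩, ?_, ?_⟩
  · intro m hm g
    obtain ⟨x, hx, y, hy, rfl⟩ := hAB g
    rw [hcl] at hm
    induction hm using Subgroup.closure_induction with
    | mem m hm =>
      obtain ⟨a, ha, b, hb, rfl⟩ := hm
      obtain ⟨a', ha', h1⟩ := hconjB y hy a ha
      obtain ⟨b', hb', h2⟩ := hconjA x hx b hb
      have : x * y * ⁅a, b⁆ * (x * y)⁻¹ = ⁅a', b'⁆ := by
        rw [← h2 a' ha', ← h1 b hb]; group
      rw [this]
      exact Subgroup.commutator_mem_commutator ha' hb'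
    | one => simp
    | mul m n _ _ hm hn =>
      have : x * y * (m * n) * (x * y)⁻¹ = (x * y * m * (x * y)⁻¹) * (x * y * n * (x * y)⁻¹) := by
        group
      rw [this]
      exact mul_mem hm hn
    | inv m _ hm =>
      have : x * y * m⁻¹ * (x * y)⁻¹ = (x * y * m * (x * y)⁻¹)⁻¹ := by group
      rw [this]
      exact inv_mem hm
  · have hgen : ∀ m ∈ {g | ∃ g₁ ∈ A, ∃ g₂ ∈ B, ⁅g₁, g₂⁆ = g},
        ∀ n ∈ {g | ∃ g₁ ∈ A, ∃ g₂ ∈ B, ⁅g₁, g₂⁆ = g}, m * n = n * m := by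
      rintro _ ⟨x, hx, y, hy, rfl⟩ _ ⟨a, ha, b, hb, rfl⟩
      obtain ⟨a₀, ha₀, h3⟩ := hconjB y⁻¹ (inv_mem hy) a ha
      obtain ⟨b₀, hb₀, h4⟩ := hconjA x⁻¹ (inv_mem hx) b hb
      have e₀ : x⁻¹ * y⁻¹ * ⁅a, b⁆ * (x⁻¹ * y⁻¹)⁻¹ = y⁻¹ * x⁻¹ * ⁅a, b⁆ * (y⁻¹ * x⁻¹)⁻¹ := by
        calc x⁻¹ * y⁻¹ * ⁅a, b⁆ * (x⁻¹ * y⁻¹)⁻¹ = x⁻¹ * (y⁻¹ * ⁅a, b⁆ * y⁻¹⁻¹) * x⁻¹⁻¹ := by group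
          _ = y⁻¹ * (x⁻¹ * ⁅a, b⁆ * x⁻¹⁻¹) * y⁻¹⁻¹ := by
            rw [h3 b hb, h4 a₀ ha₀, h4 a ha, h3 b₀ hb₀]
          _ = _ := by group
      calc ⁅x, y⁆ * ⁅a, b⁆ = x * y * (x⁻¹ * y⁻¹ * ⁅a, b⁆ * (x⁻¹ * y⁻¹)⁻¹) * (x⁻¹ * y⁻¹) := by
            rw [commutatorElement_def x y]; group
        _ = ⁅a, b⁆ * ⁅x, y⁆ := by
            rw [e₀, commutatorElement_def x y]; group
    have := Subgroup.isMulCommutative_closure hgen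
    intro m hm n hn
    rw [hcl] at hm hn
    exact congrArg Subtype.val (this.is_comm.comm (⟨m, hm⟩ : Subgroup.closure _) ⟨n, hn⟩)
  · intro a ha b hb
    exact Subgroup.commutator_mem_commutator ha hb

end AbelianFactors

/-! ### The case of trivial core. -/

section CoreFree

variable {G : Type*} [Group G] {A B : Subgroup G}

/-- A central element of finite order in `G = AB`, with `B` torsion-free, lies in the core of `A`. -/
theorem eq_one_of_isOfFinOrder_of_central (hG : (A : Set G) * (B : Set G) = Set.univ)
    (hAper : ∀ x ∈ A, IsOfFinOrder x) (hBtf : ∀ x ∈ B, IsOfFinOrder x → x = 1)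
    (hcore : A.normalCore = ⊥) {e : G} (he : IsOfFinOrder e) (hcent : ∀ g, g * e = e * g) :
    e = 1 := by
  obtain ⟨x, hx, y, hy, rfl⟩ := Set.mem_mul.1 (hG ▸ Set.mem_univ e)
  have hcomm : Commute x⁻¹ (x * y) := hcent _
  have hy1 : y = 1 := hBtf y hy (by
    have := hcomm.isOfFinOrder_mul (hAper _ (inv_mem hx)) he
    rwa [inv_mul_cancel_left] at this)
  subst hy1
  rw [mul_one] at *
  rw [← Subgroup.mem_bot, ← hcore]
  intro g
  rw [hcent, mul_inv_cancel_right]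
  exact hx

/-- In `G = AB` with `A` periodic and core-free and `B` torsion-free, abelian normal subgroups
are torsion-free. -/
theorem eq_one_of_isOfFinOrder_of_mem_normal (hG : (A : Set G) * (B : Set G) = Set.univ)
    (hAper : ∀ x ∈ A, IsOfFinOrder x) (hBtf : ∀ x ∈ B, IsOfFinOrder x → x = 1)
    (hcore : A.normalCore = ⊥) {M : Subgroup G} (hMn : M.Normal)
    (hM : ∀ x ∈ M, ∀ y ∈ M, x * y = y * x) {t : G} (ht : t ∈ M) (hfin : IsOfFinOrder t) :
    t = 1 := by
  have key : ∀ t ∈ M, IsOfFinOrder t → t ∈ A := by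
    intro t ht hfin
    obtain ⟨x, hx, y, hy, rfl⟩ := Set.mem_mul.1 (hG ▸ Set.mem_univ t)
    have hxi : x⁻¹ ∈ A := inv_mem hx
    -- Modulo the torsion of `M`, `y` is `x⁻¹`; hence `y` has finite order.
    have hpow (n : ℕ) : ∃ s ∈ M, IsOfFinOrder s ∧ y ^ n = s * x⁻¹ ^ n := by
      induction n with
      | zero => exact ⟨1, one_mem _, IsOfFinOrder.one, by simp⟩
      | succ n ih =>
        obtain ⟨s, hs, hsf, h⟩ := ih
        refine ⟨s * (x⁻¹ ^ (n + 1) * (x * y) * (x⁻¹ ^ (n + 1))⁻¹), mul_mem hs (hMn.conj_mem _ ht _),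
          Commute.isOfFinOrder_mul (hM _ hs _ (hMn.conj_mem _ ht _)) hsf ?_, ?_⟩
        · exact (isConj_iff.2 ⟨_, rfl⟩).isOfFinOrder hfin
        · rw [pow_succ, h, pow_succ]
          group
    obtain ⟨n, hn, hxn⟩ := isOfFinOrder_iff_pow_eq_one.1 (hAper _ hxi)
    obtain ⟨s, hs, hsf, h⟩ := hpow n
    rw [hxn, mul_one] at h
    have hy1 : y = 1 := hBtf y hy (IsOfFinOrder.of_pow (by rwa [h]) hn.ne')
    rw [hy1, mul_one]
    exact hx
  rw [← Subgroup.mem_bot, ← hcore]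
  intro g
  refine key _ (hMn.conj_mem _ ht _) ?_
  exact (isConj_iff.2 ⟨_, rfl⟩).isOfFinOrder hfin

/-- The core-free case: `A` has order at most two and its nontrivial element inverts `B`. -/
theorem eq_one_or_eq_of_normalCore_eq_bot (hG : (A : Set G) * (B : Set G) = Set.univ)
    (hA : ∀ x ∈ A, ∀ y ∈ A, x * y = y * x) (hB : ∀ x ∈ B, ∀ y ∈ B, x * y = y * x)
    (hAper : ∀ x ∈ A, IsOfFinOrder x) (hBtf : ∀ x ∈ B, IsOfFinOrder x → x = 1)
    (hrank : ∀ x ∈ B, ∀ y ∈ B, x ≠ 1 → ∃ r s : ℤ, r ≠ 0 ∧ y ^ r = x ^ s)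
    (hcore : A.normalCore = ⊥) :
    (∀ x ∈ A, ∀ y ∈ A, x ≠ 1 → y ≠ 1 → x * y = 1) ∧
      ∀ x ∈ A, x ≠ 1 → ∀ b ∈ B, b * (x⁻¹ * b * x) = 1 := by
  obtain ⟨M, hMn, hM, hcomm⟩ := exists_normal_comm_of_mul_eq_univ hG hA hB
  have hcent {e : G} := eq_one_of_isOfFinOrder_of_central hG hAper hBtf hcore (e := e)
  have htf : ∀ t ∈ M, ∀ n : ℤ, n ≠ 0 → t ^ n = 1 → t = 1 := fun t ht n hn h =>
    eq_one_of_isOfFinOrder_of_mem_normal hG hAper hBtf hcore hMn hM ht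
      (isOfFinOrder_iff_zpow_eq_one.2 ⟨n, hn, h⟩)
  have hinj : ∀ s ∈ M, ∀ t ∈ M, ∀ n : ℤ, n ≠ 0 → s ^ n = t ^ n → s = t := by
    intro s hs t ht n hn h
    refine mul_inv_eq_one.1 (htf _ (mul_mem hs (inv_mem ht)) n hn ?_)
    have : Commute s t⁻¹ := hM s hs _ (inv_mem ht)
    rw [this.mul_zpow, h, inv_zpow, mul_inv_cancel]
  have hdecomp : ∀ m : G, ∃ x ∈ A, m * x ∈ B := by
    intro m
    obtain ⟨x, hx, y, hy, h⟩ := Set.mem_mul.1 (hG ▸ Set.mem_univ m⁻¹)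
    refine ⟨x, hx, ?_⟩
    have : m * x = y⁻¹ := by rw [← inv_inv m, ← h]; group
    rw [this]
    exact inv_mem hy
  -- every element of `M` has a nontrivial power in `B`
  have hpow : ∀ m ∈ M, ∃ n : ℤ, n ≠ 0 ∧ m ^ n ∈ B := by
    intro m hm
    obtain ⟨x, hx, hmx⟩ := hdecomp m
    obtain ⟨y, hy, hmy⟩ := hdecomp (m ^ 2)
    let : CommGroup M := { (inferInstance : Group M) with
      mul_comm := fun a b => Subtype.ext (hM _ a.2 _ b.2) }
    have hfix : (MulAut.conjNormal x : MulAut M) ⟨m, hm⟩ = ⟨m, hm⟩ := by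
      refine MulAut.apply_eq_of_sq_eq_mul (ψ := MulAut.conjNormal y) ?_ ?_ ?_ ?_ ?_
      · intro u hu
        obtain ⟨n, hn, h⟩ := isOfFinOrder_iff_zpow_eq_one.1 hu
        exact Subtype.ext (htf u u.2 n hn (by simpa using congrArg Subtype.val h))
      · exact Commute.map (hA x hx y hy) (MulAut.conjNormal : G →* MulAut M)
      · exact MonoidHom.isOfFinOrder (MulAut.conjNormal : G →* MulAut M) (hAper x hx)
      · exact MonoidHom.isOfFinOrder (MulAut.conjNormal : G →* MulAut M) (hAper y hy)
      · refine Subtype.ext ?_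
        -- The elements `m * x` and `m ^ 2 * y` of `B` commute; cancelling leaves the midpoint
        -- relation.
        have h3 := hB _ hmx _ hmy
        have h4 : m * (x * m * x⁻¹) ^ 2 * (x * y) = m * (m * (y * m * y⁻¹)) * (x * y) := by
          calc m * (x * m * x⁻¹) ^ 2 * (x * y) = m * x * (m ^ 2 * y) := by
                rw [pow_two, pow_two]; group
            _ = m ^ 2 * y * (m * x) := h3
            _ = m * (m * (y * m * y⁻¹)) * (y * x) := by rw [pow_two]; group
            _ = _ := by rw [hA x hx y hy]
        simpa using mul_left_cancel (mul_right_cancel h4)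
    have hxm : Commute m x := by
      have : x * m * x⁻¹ = m := by simpa using congrArg Subtype.val hfix
      exact (mul_inv_eq_iff_eq_mul.1 this).symm
    obtain ⟨n, hn, h⟩ := isOfFinOrder_iff_zpow_eq_one.1 (hAper x hx)
    refine ⟨n, hn, ?_⟩
    have := zpow_mem hmx n
    rwa [hxm.mul_zpow, h, mul_one] at this
  have hrankM : ∀ m ∈ M, ∀ k ∈ M, m ≠ 1 → ∃ r s : ℤ, r ≠ 0 ∧ k ^ r = m ^ s := by
    intro m hm k hk hm1
    obtain ⟨i, hi, hmi⟩ := hpow m hm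
    obtain ⟨j, hj, hkj⟩ := hpow k hk
    obtain ⟨r, s, hr, h⟩ := hrank _ hmi _ hkj (fun h => hm1 (htf m hm i hi h))
    exact ⟨j * r, i * s, mul_ne_zero hj hr, by rw [zpow_mul, zpow_mul, h]⟩
  have hBM : ∀ b ∈ B, ∀ m ∈ M, b * m = m * b := by
    intro b hb m hm
    obtain ⟨n, hn, hmn⟩ := hpow m hm
    refine mul_inv_eq_iff_eq_mul.1 (hinj _ (hMn.conj_mem m hm b) m hm n hn ?_)
    rw [conj_zpow, hB b hb _ hmn, mul_inv_cancel_right]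
  have hAM : ∀ x ∈ A, (∀ m ∈ M, x * m = m * x) → x = 1 := by
    intro x hx hxM
    refine hcent (hAper x hx) fun g => ?_
    obtain ⟨y, hy, b, hb, rfl⟩ := Set.mem_mul.1 (hG ▸ Set.mem_univ g)
    -- The commutator `c` lies in `M`, so commutes with `x`; as `c⁻¹ * x` is conjugate to `x`, `c`
    -- is torsion, hence trivial.
    have hxb : x * b = b * x := by
      have hc : x * b * x⁻¹ * b⁻¹ ∈ M := hcomm x hx b hb
      obtain ⟨n, hn, h⟩ := isOfFinOrder_iff_zpow_eq_one.1 (hAper x hx)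
      have h1 : Commute (x * b * x⁻¹ * b⁻¹)⁻¹ x :=
        (Commute.inv_left (show Commute _ x from (hxM _ hc).symm))
      have h2 : (x * b * x⁻¹ * b⁻¹)⁻¹ ^ n = 1 := by
        have h3 := h1.mul_zpow n
        have h4 : (x * b * x⁻¹ * b⁻¹)⁻¹ * x = b * x * b⁻¹ := by group
        rw [h4, conj_zpow, h, mul_one, mul_inv_cancel, mul_one] at h3
        exact h3.symm
      have h5 := htf _ (inv_mem hc) n hn h2
      rw [inv_eq_one] at h5
      exact mul_inv_eq_iff_eq_mul.1 (mul_inv_eq_one.1 h5)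
    rw [mul_assoc, ← hxb, ← mul_assoc, hA y hy x hx, mul_assoc]
  -- a nontrivial element of `A` inverts `M`
  have hinv : ∀ x ∈ A, x ≠ 1 → ∀ m ∈ M, x * m * x⁻¹ = m⁻¹ := by
    intro x hx hx1 m hm
    by_cases hm1 : m = 1
    · simp [hm1]
    have hxm := hMn.conj_mem m hm x
    obtain ⟨p, q, hp, hpq⟩ := hrankM m hm _ hxm hm1
    -- Conjugation by `x` acts as the ratio `q / p`; taking `i` with `x ^ i = 1` forces `q / p =
    -- ±1`.
    have hiter (i : ℕ) : (x ^ i * m * (x ^ i)⁻¹) ^ (p ^ i) = m ^ (q ^ i) := by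
      induction i with
      | zero => simp
      | succ i ih =>
        have : x ^ (i + 1) * m * (x ^ (i + 1))⁻¹ = x ^ i * (x * m * x⁻¹) * (x ^ i)⁻¹ := by
          rw [pow_succ]; group
        rw [this, pow_succ' p, zpow_mul, conj_zpow, hpq, ← conj_zpow, ← zpow_mul, mul_comm q,
          zpow_mul, ih, ← zpow_mul, pow_succ]
    obtain ⟨n, hn, h⟩ := isOfFinOrder_iff_pow_eq_one.1 (hAper x hx)
    have hpqn : p ^ n = q ^ n := by
      have h1 := hiter n
      rw [h, one_mul, inv_one, mul_one] at h1
      by_contra hne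
      refine hm1 (htf m hm (p ^ n - q ^ n) (sub_ne_zero.2 hne) ?_)
      rw [zpow_sub, h1, mul_inv_cancel]
    have habs : |p| = |q| := by
      have h1 : |p| ^ n = |q| ^ n := by rw [← abs_pow, ← abs_pow, hpqn]
      exact (pow_left_inj₀ (abs_nonneg p) (abs_nonneg q) hn.ne').1 h1
    rcases abs_eq_abs.1 habs with rfl | rfl
    · exfalso
      refine hx1 (hAM x hx fun k hk => ?_)
      have h1 := hinj _ hxm m hm p hp hpq
      obtain ⟨r, s, hr, hrs⟩ := hrankM m hm k hk hm1
      refine mul_inv_eq_iff_eq_mul.1 (hinj _ (hMn.conj_mem k hk x) k hk r hr ?_)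
      rw [conj_zpow, hrs, ← conj_zpow, h1]
    · refine hinj _ hxm _ (inv_mem hm) (-q) hp ?_
      rw [hpq, inv_zpow, zpow_neg, inv_inv]
  have htwo : ∀ x ∈ A, ∀ y ∈ A, x ≠ 1 → y ≠ 1 → x * y = 1 := by
    intro x hx y hy hx1 hy1
    refine hAM _ (mul_mem hx hy) fun m hm => mul_inv_eq_iff_eq_mul.1 ?_
    calc x * y * m * (x * y)⁻¹ = x * (y * m * y⁻¹) * x⁻¹ := by group
      _ = m := by rw [hinv y hy hy1 m hm, hinv x hx hx1 _ (inv_mem hm), inv_inv]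
  refine ⟨htwo, fun x hx hx1 b hb => ?_⟩
  have hxx : x * x = 1 := htwo x hx x hx hx1 hx1
  have hxi : x⁻¹ = x := inv_eq_of_mul_eq_one_left hxx
  obtain ⟨m, hm, hm1⟩ : ∃ m ∈ M, m ≠ 1 := by
    by_contra! hall
    exact hx1 (hAM x hx fun m hm => by rw [hall m hm, mul_one, one_mul])
  obtain ⟨n, hn, hmn⟩ := hpow m hm
  obtain ⟨r, s, hr, hrs⟩ := hrank _ hmn b hb (fun h => hm1 (htf m hm n hn h))
  have hd : x * b * x⁻¹ * b⁻¹ ∈ M := hcomm x hx b hb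
  have hbd : Commute b (x * b * x⁻¹) := by
    have h1 : Commute b (x * b * x⁻¹ * b⁻¹) := hBM b hb _ hd
    have h2 := h1.mul_right (Commute.refl b)
    rwa [inv_mul_cancel_right] at h2
  rw [hxi]
  rw [hxi] at hbd hd
  -- `b * b ^ x` is torsion because `b ^ r ∈ M` is inverted by `x`; being also central, it is
  -- trivial.
  refine hcent (isOfFinOrder_iff_zpow_eq_one.2 ⟨r, hr, ?_⟩) fun g => ?_
  · have h1 := hinv x hx hx1 _ (zpow_mem (zpow_mem hm n) s)
    rw [← hrs, ← conj_zpow, hxi] at h1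
    rw [hbd.mul_zpow, h1, mul_inv_cancel]
  · obtain ⟨y, hy, c, hc, rfl⟩ := Set.mem_mul.1 (hG ▸ Set.mem_univ g)
    have hcb : Commute c (b * (x * b * x)) := by
      have h1 : Commute c b := hB c hc b hb
      have h2 : Commute c (x * b * x * b⁻¹) := hBM c hc _ hd
      have h3 := h2.mul_right h1
      rw [inv_mul_cancel_right] at h3
      exact h1.mul_right h3
    have hxb : Commute x (b * (x * b * x)) := by
      calc x * (b * (x * b * x)) = x * b * x * b * x := by group
        _ = b * (x * b * x) * x := by rw [← hbd.eq]
    have hyb : Commute y (b * (x * b * x)) := by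
      by_cases hy1 : y = 1
      · rw [hy1]; exact Commute.one_left _
      · rw [eq_inv_of_mul_eq_one_left (htwo y hy x hx hy1 hx1), hxi]; exact hxb
    exact hyb.mul_left hcb

end CoreFree

/-! ### Lifting from the quotient by the core. -/

theorem theorem4p3 {G : Type*} [Group G] (A B : Subgroup G)
    (hG : (A : Set G) * (B : Set G) = Set.univ)
    (hA : IsLocallyCyclic A) (hAper : ∀ x ∈ A, IsOfFinOrder x)
    (hB : IsLocallyCyclic B) (hBtf : ∀ x ∈ B, IsOfFinOrder x → x = 1) (hBne : B ≠ ⊥) :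
    (A.Normal ∧ IsInternalSemidirect ⊤ A B) ∨
    (∃ (A₁ : Subgroup G) (a : G),
      (A : Set G) = (A₁ : Set G) * (Subgroup.zpowers a : Set G) ∧
      a ^ 2 ∈ A₁ ∧
      A₁.Normal ∧
      IsInternalSemidirect (A₁ ⊔ B) A₁ B ∧
      ((A₁ ⊔ B : Subgroup G) : Set G) * (Subgroup.zpowers a : Set G) = Set.univ ∧
      ∃ φ : B → A₁, IsConjDerivation φ ∧
        ∀ b : B, a⁻¹ * (b : G) * a = (b : G)⁻¹ * (φ b : G)) := by
  set N := A.normalCore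
  have hNA : N ≤ A := A.normalCore_le
  have hinf : ∀ x ∈ A, x ∈ B → x = 1 := fun x hx hy => hBtf x hy (hAper x hx)
  let π := QuotientGroup.mk' N
  have hπ : ∀ g, π g = 1 ↔ g ∈ N := fun g => QuotientGroup.eq_one_iff g
  have hπs : Function.Surjective π := QuotientGroup.mk'_surjective N
  have hdec (g : G) : ∃ x ∈ A, ∃ y ∈ B, x * y = g := Set.mem_mul.1 (hG ▸ Set.mem_univ g)
  have key := eq_one_or_eq_of_normalCore_eq_bot (A := A.map π) (B := B.map π)
    (by
      rw [Set.eq_univ_iff_forall]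
      intro q
      obtain ⟨g, rfl⟩ := hπs q
      obtain ⟨x, hx, y, hy, rfl⟩ := hdec g
      exact Set.mem_mul.2 ⟨π x, Subgroup.mem_map_of_mem π hx, π y,
        Subgroup.mem_map_of_mem π hy, (map_mul π x y).symm⟩)
    (by
      rintro _ ⟨x, hx, rfl⟩ _ ⟨y, hy, rfl⟩
      rw [← map_mul, hA.mul_comm hx hy, map_mul])
    (by
      rintro _ ⟨x, hx, rfl⟩ _ ⟨y, hy, rfl⟩
      rw [← map_mul, hB.mul_comm hx hy, map_mul])
    (by
      rintro _ ⟨x, hx, rfl⟩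
      exact π.isOfFinOrder (hAper x hx))
    (by
      rintro _ ⟨y, hy, rfl⟩ hfin
      obtain ⟨n, hn, h⟩ := isOfFinOrder_iff_zpow_eq_one.1 hfin
      rw [← map_zpow, hπ] at h
      have h1 := hinf _ (hNA h) (zpow_mem hy n)
      rw [hBtf y hy (isOfFinOrder_iff_zpow_eq_one.2 ⟨n, hn, h1⟩), map_one])
    (by
      rintro _ ⟨x, hx, rfl⟩ _ ⟨y, hy, rfl⟩ hx1
      obtain ⟨r, s, hr, h⟩ := hB.exists_zpow_eq_zpow hx hy
        (by rintro rfl; exact hx1 (map_one π))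
      exact ⟨r, s, hr, by rw [← map_zpow, h, map_zpow]⟩)
    (by
      rw [eq_bot_iff]
      intro q hq
      obtain ⟨t, rfl⟩ := hπs q
      rw [Subgroup.mem_bot, hπ]
      intro g
      obtain ⟨x, hx, h⟩ := hq (π g)
      have h1 : x⁻¹ * (g * t * g⁻¹) ∈ N := by
        rw [← hπ]
        simp only [map_mul, map_inv] at h ⊢
        rw [h, inv_mul_cancel]
      simpa using mul_mem hx (hNA h1))
  obtain ⟨htwo, hinv⟩ := key
  by_cases hAN : A ≤ N
  · have hAn : A.Normal := by
      rw [le_antisymm hAN hNA]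
      exact A.normalCore_normal
    refine Or.inl ⟨hAn, le_top, le_top, hAn.subgroupOf _, by rw [hG, Subgroup.coe_top], ?_⟩
    exact eq_bot_iff.2 fun x hx => Subgroup.mem_bot.2 (hinf x hx.1 hx.2)
  obtain ⟨a, ha, haN⟩ := SetLike.not_le_iff_exists.1 hAN
  have hNn : N.Normal := A.normalCore_normal
  have htwo' : ∀ x ∈ A, x ∉ N → x * a ∈ N := by
    intro x hx hxN
    rw [← hπ, map_mul]
    exact htwo _ (Subgroup.mem_map_of_mem π hx) _ (Subgroup.mem_map_of_mem π ha)
      (mt (hπ x).1 hxN) (mt (hπ a).1 haN)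
  have hdecA : ∀ x ∈ A, ∃ y ∈ N, ∃ z ∈ Subgroup.zpowers a, y * z = x := by
    intro x hx
    by_cases hxN : x ∈ N
    · exact ⟨x, hxN, 1, one_mem _, mul_one x⟩
    · exact ⟨x * a, htwo' x hx hxN, a⁻¹, inv_mem (Subgroup.mem_zpowers a), mul_inv_cancel_right x a⟩
  have haa : a ^ 2 ∈ N := by rw [pow_two]; exact htwo' a ha haN
  have hφmem : ∀ b : B, (b : G) * (a⁻¹ * b * a) ∈ N := by
    intro b
    rw [← hπ]
    simpa only [map_mul, map_inv] using hinv _ (Subgroup.mem_map_of_mem π ha)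
      (mt (hπ a).1 haN) _ (Subgroup.mem_map_of_mem π b.2)
  refine Or.inr ⟨N, a, ?_, haa, hNn,
    ⟨le_sup_left, le_sup_right, hNn.subgroupOf _, Subgroup.normal_mul N B |>.symm, ?_⟩, ?_,
    fun b => ⟨_, hφmem b⟩, ?_, ?_⟩
  · ext x
    refine ⟨fun hx => Set.mem_mul.2 (hdecA x hx), ?_⟩
    rintro ⟨y, hy, z, hz, rfl⟩
    exact mul_mem (hNA hy) ((Subgroup.zpowers_le.2 ha) hz)
  · exact eq_bot_iff.2 fun x hx => Subgroup.mem_bot.2 (hinf x (hNA hx.1) hx.2)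
  · rw [Set.eq_univ_iff_forall]
    intro g
    -- Decomposing `g⁻¹` puts the `B`-factor of `g` on the left.
    obtain ⟨x, hx, b, hb, h⟩ := hdec g⁻¹
    obtain ⟨y, hy, z, hz, hyz⟩ := hdecA x⁻¹ (inv_mem hx)
    refine Set.mem_mul.2 ⟨b⁻¹ * y, mul_mem (inv_mem (le_sup_right (a := N) hb))
      (le_sup_left (b := B) hy), z, hz, ?_⟩
    rw [mul_assoc, hyz, ← mul_inv_rev, h, inv_inv]
  · -- `b` and its inverse act alike on `N`, because `a` centralizes `N`
    have hact : ∀ c : B, ∀ m ∈ N, (c : G) * m * (c : G)⁻¹ = (c : G)⁻¹ * m * c := by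
      intro c m hm
      have hk : (c : G) * m * (c : G)⁻¹ ∈ N := hNn.conj_mem m hm c
      calc (c : G) * m * (c : G)⁻¹ = a⁻¹ * (a * (c * m * (c : G)⁻¹)) := by group
        _ = (a⁻¹ * c * a) * (a⁻¹ * (m * a)) * (a⁻¹ * c * a)⁻¹ := by
          rw [hA.mul_comm ha (hNA hk)]; group
        _ = (c : G)⁻¹ * ((c * (a⁻¹ * c * a)) * m * (c * (a⁻¹ * c * a))⁻¹) * c := by
          rw [hA.mul_comm (hNA hm) ha]; group
        _ = (c : G)⁻¹ * m * c := by
          rw [hA.mul_comm (hNA (hφmem c)) (hNA hm), mul_inv_cancel_right]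
    intro b c
    -- Expanding `φ (b * c)` produces `φ b` conjugated by `c⁻¹`; `hact` trades this for `c`.
    rw [← hact c _ (hφmem b)]
    calc ((b * c : B) : G) * (a⁻¹ * (b * c : B) * a)
        = b * c * (a⁻¹ * b * a) * (a⁻¹ * c * a) := by push_cast; group
      _ = _ := by rw [hB.mul_comm b.2 c.2]; group
  · intro b
    simp [mul_assoc]
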